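/- Let $d\ge 1$ and $[d]=\{1,\dots,d\}$. For $P\subseteq\mathbb R\times[d]$, the $i$-th level of $P$ is $\{x\in\mathbb R:(x,i)\in P\}$. A *separated $d$-interval* is a set $I\subseteq\mathbb R\times[d]$ all of whose $d$ levels are (possibly empty) convex subsets of $\mathbb R$. Put $\mathcal C=\mathcal C_\equiv(P)=\{I\cap P: I \text{ is a separated } d\text{-interval}\}$. Then $(P,\mathcal C)$ is a convexity space: $\mathcal C$ contains $\emptyset$ and $P$ and is closed under intersections of nonempty subfamilies and under unions of nonempty chains. For $Y\subseteq P$ let $\operatorname{conv}Y=\bigcap\{C\in\mathcal C:Y\subseteq C\}$. Sets *intersect* if they have a common point in $P$; a *finite family* is a finite set of members of $\mathcal C$. * The *Radon number* $r$ is the least $n$ such that every $Y\subseteq P$ with at least $n$ points has a partition $Y=A\sqcup B$ with $\operatorname{conv}A\cap\operatorname{conv}B\ne\emptyset$. * The *Helly number* $h$ is the least $n$ such that, for every finite family $\mathcal F$, if every at most $n$ members of $\mathcal F$ intersect, then all members of $\mathcal F$ intersect. * The *colorful Helly number* $h_c$ is the least $n$ such that, for any $n$ nonempty finite families $\mathcal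 F_1,\dots,\mathcal F_n$ with $\bigcap_i C_i\neq\emptyset$ for all $C_1\in\mathcal F_1,\dots,C_n\in\mathcal F_n$, the members of some $\mathcal F_i$ intersect. * The *fractional Helly number* $h_f$ is the least $k$ for which there is a function $\beta:(0,1)\to(0,1)$ such that, for every $\alpha\in(0,1)$, every finite family $\mathcal F$ with $|\mathcal F|\ge k$ and with at least $\alpha\binom{|\mathcal F|}{k}$ intersecting $k$-element subfamilies has an intersecting subfamily of size at least $\beta(\alpha)|\mathcal F|$. **Theorem.** For every $d\ge1$ and every $P\subseteq\mathbb R\times[d]$ (so, in particular, all four numbers exist): 1. $r\le 2d+1$, and $r=2d+1$ if every level of $P$ has at least $2$ points. 2. $h\le 2d$, and $h=2d$ if every level of $P$ has at least $2$ points. 3. $h_c\le 2d$, and $h_c=2d$ if every level of $P$ has at least $2$ points. 4. $h_f\le 2$, and $h_f=2$ if $P$ is infinite. 5. ($(p,q)$ theorem) For all integers $p\ge q\ge2$ there is $N$ such that, for every finite family $\mathcal F$ of nonempty members of $\mathcal C$ in which among any $p$ members some $q$ intersect, there is $S\subseteq P$ with $|S|\le N$ that meets every member of $\mathcal F$. 6.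 (First colorful $(p,q)$ theorem) For all integers $p\ge q\ge2$ there is $N_c$ such that the following holds for all finite families $\mathcal F_1,\dots,\mathcal F_q$ of nonempty members of $\mathcal C$. If for every choice of distinct $C_{i,1},\dots,C_{i,p}\in\mathcal F_i$ (for each $i\in[q]$) there are $j_1,\dots,j_q\in[p]$ with $\bigcap_{i=1}^q C_{i,j_i}\ne\emptyset$, then there are $i\in[q]$ and $S\subseteq P$ with $|S|\le N_c$ such that $S$ meets every member of $\mathcal F_i$. 7. (Second colorful $(p,q)$ theorem) For all integers $p\ge q\ge2$ there is $M_c$ such that the following holds for all finite families $\mathcal F_1,\dots,\mathcal F_p$ of members of $\mathcal C$. If for every choice of $C_i\in\mathcal F_i$ ($i\in[p]$) there is a $q$-element set $J\subseteq[p]$ with $\bigcap_{i\in J}C_i\ne\emptyset$, then there are $i\in[p]$ and $S\subseteq P$ with $|S|\le M_c$ such that $S$ meets every member of $\mathcal F_i$. The constants $N,N_c,M_c$ may depend on $P$, $d$, $p$, $q$ but not on the families. -/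

import Mathlib

/-- A convexity space on the ground set `X`. -/
structure ConvexitySpace (X : Type*) where
  /-- The convex sets. -/
  sets : Set (Set X)
  empty_mem : ∅ ∈ sets
  univ_mem : Set.univ ∈ sets
  sInter_mem : ∀ D : Set (Set X), D.Nonempty → D ⊆ sets → ⋂₀ D ∈ sets
  sUnion_mem : ∀ D : Set (Set X), D.Nonempty → D ⊆ sets → IsChain (· ⊆ ·) D → ⋃₀ D ∈ sets

/-- The members of a family of sets have a common point. -/
def Intersecting {X : Type*} (F : Set (Set X)) : Prop := (⋂₀ F).Nonempty

namespace ConvexitySpace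

variable {X : Type*} (K : ConvexitySpace X)

/-- The convex hull of `Y`. -/
def conv (Y : Set X) : Set X := ⋂₀ {C | C ∈ K.sets ∧ Y ⊆ C}

/-- `Y` has a partition into two parts whose convex hulls meet. -/
def HasRadonPartition (Y : Set X) : Prop :=
  ∃ A B : Set X, A ∪ B = Y ∧ Disjoint A B ∧ (K.conv A ∩ K.conv B).Nonempty

/-- Every set of at least `n` points, finite or infinite, has a Radon partition. -/
def RadonProperty (n : ℕ) : Prop :=
  ∀ Y : Set X, (n : ℕ∞) ≤ Y.encard → K.HasRadonPartition Y

/-- The Radon number: the least `n` with the Radon property, and `⊤` if there is none. -/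
noncomputable def radonNumber : ℕ∞ := ⨅ (n : ℕ) (_ : K.RadonProperty n), (n : ℕ∞)

/-- If every at most `n` members of a finite family of convex sets intersect, then all do. -/
def HellyProperty (n : ℕ) : Prop :=
  ∀ F : Finset (Set X), (F : Set (Set X)) ⊆ K.sets →
    (∀ G : Finset (Set X), G ⊆ F → G.card ≤ n → Intersecting (G : Set (Set X))) →
    Intersecting (F : Set (Set X))

/-- The Helly number: the least `n` with the Helly property, and `⊤` if there is none. -/
noncomputable def hellyNumber : ℕ∞ := ⨅ (n : ℕ) (_ : K.HellyProperty n), (n : ℕ∞)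

/-- For any `n` nonempty finite families of convex sets such that every colorful `n`-tuple
intersects, one of the families intersects. -/
def ColorfulHellyProperty (n : ℕ) : Prop :=
  ∀ F : Fin n → Finset (Set X), (∀ i, (F i).Nonempty ∧ (F i : Set (Set X)) ⊆ K.sets) →
    (∀ C : Fin n → Set X, (∀ i, C i ∈ F i) → (⋂ i, C i).Nonempty) →
    ∃ i, Intersecting (F i : Set (Set X))

/-- The colorful Helly number: the least `n` with the colorful Helly property, and `⊤` if there
is none. -/
noncomputable def colorfulHellyNumber : ℕ∞ :=
  ⨅ (n : ℕ) (_ : K.ColorfulHellyProperty n), (n : ℕ∞)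

open Classical in
/-- The number of intersecting `k`-tuples, that is, of subfamilies with `k` members that have a
common point. -/
noncomputable def numIntersecting (F : Finset (Set X)) (k : ℕ) : ℕ :=
  ((F.powersetCard k).filter fun G => Intersecting (G : Set (Set X))).card

/-- The space admits a fractional Helly theorem for `k`-tuples. -/
def AdmitsFractionalHelly (k : ℕ) : Prop :=
  ∃ β : ℝ → ℝ, (∀ α ∈ Set.Ioo (0 : ℝ) 1, β α ∈ Set.Ioo (0 : ℝ) 1) ∧
    ∀ α ∈ Set.Ioo (0 : ℝ) 1, ∀ F : Finset (Set X), (F : Set (Set X)) ⊆ K.sets → k ≤ F.card →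
      α * (F.card.choose k : ℝ) ≤ (numIntersecting F k : ℝ) →
      ∃ G : Finset (Set X), G ⊆ F ∧ Intersecting (G : Set (Set X)) ∧
        β α * (F.card : ℝ) ≤ (G.card : ℝ)

/-- The fractional Helly number: the least `k` such that the space admits a fractional Helly
theorem for `k`-tuples, and `⊤` if there is none. -/
noncomputable def fractionalHellyNumber : ℕ∞ :=
  ⨅ (k : ℕ) (_ : K.AdmitsFractionalHelly k), (k : ℕ∞)

/-- Every member of `F` meets `S`. -/
def Pierces (S : Finset X) (F : Finset (Set X)) : Prop := ∀ C ∈ F, ∃ x ∈ S, x ∈ C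

/-- Among any `p` members of `F` some `q` intersect. -/
def PQProperty (p q : ℕ) (F : Finset (Set X)) : Prop :=
  ∀ G : Finset (Set X), G ⊆ F → G.card = p →
    ∃ H : Finset (Set X), H ⊆ G ∧ H.card = q ∧ Intersecting (H : Set (Set X))

/-- The space admits a `(p, q)` theorem (for families of nonempty convex sets). -/
def AdmitsPQ (p q : ℕ) : Prop :=
  ∃ N : ℕ, ∀ F : Finset (Set X), (F : Set (Set X)) ⊆ K.sets → (∀ C ∈ F, C.Nonempty) →
    PQProperty p q F → ∃ S : Finset X, S.card ≤ N ∧ Pierces S F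

/-- Whenever `p` distinct sets are chosen from each of the `q` families, one can take one of the
chosen sets from each family such that these `q` sets intersect. -/
def ColorfulPQProperty₁ (p q : ℕ) (F : Fin q → Finset (Set X)) : Prop :=
  ∀ C : Fin q → Fin p → Set X, (∀ i, Function.Injective (C i)) → (∀ i j, C i j ∈ F i) →
    ∃ j : Fin q → Fin p, (⋂ i, C i (j i)).Nonempty

/-- The space admits the first kind of colorful `(p, q)` theorem (for families of nonempty convex
sets). -/
def AdmitsColorfulPQ₁ (p q : ℕ) : Prop :=
  ∃ N : ℕ, ∀ F : Fin q → Finset (Set X),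
    (∀ i, (F i : Set (Set X)) ⊆ K.sets ∧ ∀ C ∈ F i, C.Nonempty) → ColorfulPQProperty₁ p q F →
    ∃ (S : Finset X) (i : Fin q), S.card ≤ N ∧ Pierces S (F i)

/-- Whenever one set is chosen from each of the `p` families, some `q` of the chosen sets have a
common point. -/
def ColorfulPQProperty₂ (p q : ℕ) (F : Fin p → Finset (Set X)) : Prop :=
  ∀ C : Fin p → Set X, (∀ i, C i ∈ F i) →
    ∃ I : Finset (Fin p), I.card = q ∧ (⋂ i ∈ I, C i).Nonempty

/-- The space admits the second kind of colorful `(p, q)` theorem. -/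
def AdmitsColorfulPQ₂ (p q : ℕ) : Prop :=
  ∃ M : ℕ, ∀ F : Fin p → Finset (Set X), (∀ i, (F i : Set (Set X)) ⊆ K.sets) →
    ColorfulPQProperty₂ p q F →
    ∃ (S : Finset X) (i : Fin p), S.card ≤ M ∧ Pierces S (F i)

end ConvexitySpace

/-- A separated `d`-interval: a subset of `ℝ × [d]` each of whose `d` levels is convex. -/
def IsSeparatedInterval {d : ℕ} (I : Set (ℝ × Fin d)) : Prop :=
  ∀ i : Fin d, Convex ℝ {x : ℝ | (x, i) ∈ I}

/-- The traces on `P` of the separated `d`-intervals, as subsets of the ground set `P`. -/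
def traceSets {d : ℕ} (P : Set (ℝ × Fin d)) : Set (Set P) :=
  {C | ∃ I : Set (ℝ × Fin d), IsSeparatedInterval I ∧ C = Subtype.val ⁻¹' I}

theorem mem_traceSets_iff {d : ℕ} (P : Set (ℝ × Fin d)) (C : Set P) :
    C ∈ traceSets P ↔ ∀ a ∈ C, ∀ c ∈ C, ∀ b : P, a.1.2 = b.1.2 → c.1.2 = b.1.2 →
      a.1.1 ≤ b.1.1 → b.1.1 ≤ c.1.1 → b ∈ C := by
  constructor
  · rintro ⟨I, hI, rfl⟩ ⟨⟨x, i⟩, ha⟩ hx ⟨⟨z, j⟩, hc⟩ hz ⟨⟨y, k⟩, hb⟩ h1 h2 h3 h4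
    simp only [Set.mem_preimage] at hx hz h1 h2 h3 h4 ⊢
    subst h1
    subst h2
    exact (hI _).ordConnected.out hx hz ⟨h3, h4⟩
  · intro h
    refine ⟨{b | ∃ a ∈ C, ∃ c ∈ C, a.1.2 = b.2 ∧ c.1.2 = b.2 ∧ a.1.1 ≤ b.1 ∧ b.1 ≤ c.1.1},
      ?_, ?_⟩
    · intro i
      refine Set.OrdConnected.convex ⟨?_⟩
      rintro x ⟨a, ha, -, -, h1, -, h3, -⟩ z ⟨-, -, c, hc, -, h2, -, h4⟩ y ⟨hxy, hyz⟩
      exact ⟨a, ha, c, hc, h1, h2, h3.trans hxy, hyz.trans h4⟩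
    · ext b
      constructor
      · intro hb
        exact ⟨b, hb, b, hb, rfl, rfl, le_rfl, le_rfl⟩
      · rintro ⟨a, ha, c, hc, h1, h2, h3, h4⟩
        exact h a ha c hc b h1 h2 h3 h4

/-- The convexity space `(P, C_≡(P))` of the traces on `P` of the separated `d`-intervals. -/
def traceSpace {d : ℕ} (P : Set (ℝ × Fin d)) : ConvexitySpace P where
  sets := traceSets P
  empty_mem := by
    rw [mem_traceSets_iff]
    intro a ha
    exact ha.elim
  univ_mem := by
    rw [mem_traceSets_iff]
    intros
    trivial
  sInter_mem := by
    intro D _ hD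
    rw [mem_traceSets_iff]
    intro a ha c hc b h1 h2 h3 h4 C hC
    exact (mem_traceSets_iff P C).1 (hD hC) a (ha C hC) c (hc C hC) b h1 h2 h3 h4
  sUnion_mem := by
    intro D _ hD hch
    rw [mem_traceSets_iff]
    rintro a ⟨A, hA, ha⟩ c ⟨B, hB, hc⟩ b h1 h2 h3 h4
    rcases hch.total hA hB with h | h
    · exact ⟨B, hB, (mem_traceSets_iff P B).1 (hD hB) a (h ha) c hc b h1 h2 h3 h4⟩
    · exact ⟨A, hA, (mem_traceSets_iff P A).1 (hD hA) a ha c (h hc) b h1 h2 h3 h4⟩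

/-! Everything rests on ordering sets by their right ends on a level. A trace may be unbounded or
have no last point, so the right end of level `i` of `C` is encoded by the lower set `levelLower i
C`. Lower sets of `ℝ` are linearly ordered, so finite families still have members with least and
greatest right end. The greedy step is `exists_common_point`: traces that end no earlier than `C₀`
and have a point in its lower set share a point.

For colorful Helly, two color classes are assigned to each level. If no class intersects, some pair
of sets from the two classes of level `i` has no common point there, for every `i`, and these pairs
form a colorful choice without a common point. Helly follows by repeating one family. For fractional
Helly, each intersecting pair is charged to its member with the earlier right end; the sets charged
to one member on one level have a common point, so many pairs force a large intersecting subfamily.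
The lower bounds for `r` and `h` use two points on each level.

The three (p,q) theorems follow from a dichotomy, `exists_disjointOn_or_pierces`: a family has many
pairwise disjoint members or a bounded piercing set. It is proved by adding one level at a time. On
the new level, `exists_separated_or_pierces` finds many separated subfamilies that are each hard to
pierce; by induction each contains a long sequence disjoint on the old levels, and repeated halving
with `exists_cross_disjoint` makes members of different sequences disjoint there as well. -/

/-! ### Lower sets as right ends -/

/-- The lower set of reals generated by the `i`-th level of `C`. -/
def levelLower {d : ℕ} {P : Set (ℝ × Fin d)} (i : Fin d) (C : Set P) : LowerSet ℝ :=
  lowerClosure ((fun x : P => x.1.1) '' {x | x ∈ C ∧ x.1.2 = i})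

theorem mem_levelLower {d : ℕ} {P : Set (ℝ × Fin d)} {i : Fin d} {C : Set P} {t : ℝ} :
    t ∈ levelLower i C ↔ ∃ x ∈ C, x.1.2 = i ∧ t ≤ x.1.1 := by
  simp only [levelLower, mem_lowerClosure, Set.mem_image, Set.mem_ofPred_eq]
  constructor
  · rintro ⟨_, ⟨x, ⟨hx, hi⟩, rfl⟩, ht⟩
    exact ⟨x, hx, hi, ht⟩
  · rintro ⟨x, hx, hi, ht⟩
    exact ⟨_, ⟨x, ⟨hx, hi⟩, rfl⟩, ht⟩

theorem mem_levelLower_of_mem {d : ℕ} {P : Set (ℝ × Fin d)} {i : Fin d} {C : Set P} {x : P}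
    (hx : x ∈ C) (hi : x.1.2 = i) : x.1.1 ∈ levelLower i C :=
  mem_levelLower.2 ⟨x, hx, hi, le_rfl⟩

/-- Comparing right ends supplies a point of `C` at or to the right of `y`; with `x` on the left,
convexity traps `y` in `C`. -/
theorem mem_of_levelLower_le {d : ℕ} {P : Set (ℝ × Fin d)} {i : Fin d} {C₀ C : Set P}
    (hC : C ∈ traceSets P) (hle : levelLower i C₀ ≤ levelLower i C) {x y : P}
    (hy : y ∈ C₀) (hyi : y.1.2 = i) (hx : x ∈ C) (hxi : x.1.2 = i) (hxy : x.1.1 ≤ y.1.1) :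
    y ∈ C := by
  obtain ⟨z, hz, hzi, hyz⟩ := mem_levelLower.1 (hle (mem_levelLower_of_mem hy hyi))
  exact (mem_traceSets_iff P C).1 hC x hx z hz y (hxi.trans hyi.symm) (hzi.trans hyi.symm) hxy hyz

/-- Finitely many traces that reach at least as far right on level `i` as `C₀`, and that meet the
lower set generated by `C₀`, have a common point there. -/
theorem exists_common_point {d : ℕ} {P : Set (ℝ × Fin d)} {i : Fin d} {C₀ : Set P}
    {G : Finset (Set P)} (hne : G.Nonempty) (hG : (G : Set (Set P)) ⊆ traceSets P)
    (hle : ∀ C ∈ G, levelLower i C₀ ≤ levelLower i C)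
    (hmeet : ∀ C ∈ G, ∃ x ∈ C, x.1.2 = i ∧ x.1.1 ∈ levelLower i C₀) :
    ∃ y ∈ C₀, y.1.2 = i ∧ ∀ C ∈ G, y ∈ C := by
  have h : ∀ C : Set P, ∃ y : P, C ∈ G →
      y ∈ C₀ ∧ y.1.2 = i ∧ ∃ x ∈ C, x.1.2 = i ∧ x.1.1 ≤ y.1.1 := by
    intro C
    by_cases hC : C ∈ G
    · obtain ⟨x, hx, hxi, hxl⟩ := hmeet C hC
      obtain ⟨y, hy, hyi, hxy⟩ := mem_levelLower.1 hxl
      exact ⟨y, fun _ => ⟨hy, hyi, x, hx, hxi, hxy⟩⟩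
    · obtain ⟨D, hD⟩ := hne
      obtain ⟨x, -⟩ := hmeet D hD
      exact ⟨x, fun h => absurd h hC⟩
  choose y hy using h
  obtain ⟨D, hD, hmax⟩ := G.exists_max_image (fun C => (y C).1.1) hne
  refine ⟨y D, (hy D hD).1, (hy D hD).2.1, fun C hC => ?_⟩
  obtain ⟨-, -, x, hx, hxi, hxy⟩ := hy C hC
  exact mem_of_levelLower_le (hG hC) (hle C hC) (hy D hD).1 (hy D hD).2.1 hx hxi
    (hxy.trans (hmax C hC))

/-! ### Disjointness on sets of levels, and halving -/

/-- `C` and `D` have no common point on the levels in `S`. -/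
def DisjointOn {d : ℕ} {P : Set (ℝ × Fin d)} (S : Finset (Fin d)) (C D : Set P) : Prop :=
  ∀ x ∈ C, x ∈ D → x.1.2 ∉ S

theorem DisjointOn.symm {d : ℕ} {P : Set (ℝ × Fin d)} {S : Finset (Fin d)} {C D : Set P}
    (h : DisjointOn S C D) : DisjointOn S D C :=
  fun x hx hy => h x hy hx

theorem DisjointOn.mono {d : ℕ} {P : Set (ℝ × Fin d)} {S T : Finset (Fin d)} {C D : Set P}
    (h : DisjointOn T C D) (hST : S ⊆ T) : DisjointOn S C D :=
  fun x hx hy hS => h x hx hy (hST hS)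

theorem DisjointOn.insert {d : ℕ} {P : Set (ℝ × Fin d)} {S : Finset (Fin d)} {i : Fin d}
    {C D : Set P} (hi : DisjointOn {i} C D) (hS : DisjointOn S C D) :
    DisjointOn (insert i S) C D := by
  intro x hx hy h
  rcases Finset.mem_insert.1 h with h | h
  · exact hi x hx hy (Finset.mem_singleton.2 h)
  · exact hS x hx hy h

open Classical in
/-- Traces that are pairwise disjoint on level `i` can be cut into two halves by a lower set. -/
theorem exists_lowerSet_split {d : ℕ} {P : Set (ℝ × Fin d)} (i : Fin d) {κ : Type*}
    (u : κ → Set P) (hu : ∀ a, u a ∈ traceSets P) (A : Finset κ)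
    (hd : ∀ a ∈ A, ∀ b ∈ A, a ≠ b → DisjointOn {i} (u a) (u b)) (n : ℕ) (hA : 2 * n ≤ A.card) :
    ∃ U : LowerSet ℝ, n ≤ (A.filter fun a => ∀ x ∈ u a, x.1.2 = i → x.1.1 ∈ U).card ∧
      n ≤ (A.filter fun a => ∀ x ∈ u a, x.1.2 = i → x.1.1 ∉ U).card := by
  rcases Nat.eq_zero_or_pos n with rfl | hn
  · exact ⟨⊥, Nat.zero_le _, Nat.zero_le _⟩
  have hA0 : (A.filter fun a =>
      n ≤ (A.filter fun b => levelLower i (u b) ≤ levelLower i (u a)).card).Nonempty := by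
    obtain ⟨a, ha, hmax⟩ := A.exists_max_image (fun a => levelLower i (u a))
      (Finset.card_pos.1 (by omega))
    refine ⟨a, Finset.mem_filter.2 ⟨ha, ?_⟩⟩
    rw [Finset.filter_true_of_mem hmax]
    omega
  -- `a` has the least right end that is at least as late as those of `n` members; hence fewer than
  -- `n` members end strictly earlier.
  obtain ⟨a, ha, hmin⟩ := Finset.exists_min_image _ (fun a => levelLower i (u a)) hA0
  obtain ⟨haA, han⟩ := Finset.mem_filter.1 ha
  refine ⟨levelLower i (u a), han.trans (Finset.card_le_card ?_), ?_⟩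
  · intro b hb
    obtain ⟨hbA, hba⟩ := Finset.mem_filter.1 hb
    exact Finset.mem_filter.2 ⟨hbA, fun x hx hxi => hba (mem_levelLower_of_mem hx hxi)⟩
  have hlt : (A.filter fun b => levelLower i (u b) < levelLower i (u a)).card < n := by
    by_contra! hcon
    obtain ⟨c, hc, hmax⟩ := Finset.exists_max_image _ (fun a => levelLower i (u a))
      (Finset.card_pos.1 (hn.trans_le hcon))
    obtain ⟨hcA, hca⟩ := Finset.mem_filter.1 hc
    refine absurd (hmin c (Finset.mem_filter.2 ⟨hcA, hcon.trans (Finset.card_le_card ?_)⟩))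
      (not_le.2 hca)
    intro b hb
    exact Finset.mem_filter.2 ⟨(Finset.mem_filter.1 hb).1, hmax b hb⟩
  -- A member ending no earlier than `a` and having a point in its lower set shares a point with
  -- `a`, so it is `a`. Thus at most `(n - 1) + 1` of the `2 * n` members fail to avoid the cut.
  have hsub : A ⊆ (A.filter fun a' => ∀ x ∈ u a', x.1.2 = i → x.1.1 ∉ levelLower i (u a)) ∪
      insert a (A.filter fun b => levelLower i (u b) < levelLower i (u a)) := by
    intro b hb
    by_contra hcon
    simp only [Finset.mem_union, Finset.mem_insert, Finset.mem_filter, hb, true_and, not_or,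
      not_lt, not_forall, not_not] at hcon
    obtain ⟨⟨x, hx, hxi, hxl⟩, hba, hle⟩ := hcon
    obtain ⟨y, hy, hyi, hxy⟩ := mem_levelLower.1 hxl
    exact hd b hb a haA hba y (mem_of_levelLower_le (hu b) hle hy hyi hx hxi hxy) hy
      (Finset.mem_singleton.2 hyi)
  have h1 := (Finset.card_le_card hsub).trans (Finset.card_union_le _ _)
  have h2 := Finset.card_insert_le a
    (A.filter fun b => levelLower i (u b) < levelLower i (u a))
  omega

open Classical in
/-- Two large subfamilies, each pairwise disjoint on level `i`, have halves that are disjoint from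
each other on level `i`. -/
theorem exists_cross_disjoint {d : ℕ} {P : Set (ℝ × Fin d)} (i : Fin d) {κ κ' : Type*}
    (u : κ → Set P) (hu : ∀ a, u a ∈ traceSets P) (v : κ' → Set P) (hv : ∀ a, v a ∈ traceSets P)
    (A : Finset κ) (hA : ∀ a ∈ A, ∀ b ∈ A, a ≠ b → DisjointOn {i} (u a) (u b))
    (B : Finset κ') (hB : ∀ a ∈ B, ∀ b ∈ B, a ≠ b → DisjointOn {i} (v a) (v b))
    (n : ℕ) (hAn : 2 * n ≤ A.card) (hBn : 2 * n ≤ B.card) :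
    ∃ A' ⊆ A, ∃ B' ⊆ B, n ≤ A'.card ∧ n ≤ B'.card ∧
      ∀ a ∈ A', ∀ b ∈ B', DisjointOn {i} (u a) (v b) := by
  obtain ⟨U, hU1, hU2⟩ := exists_lowerSet_split i u hu A hA n hAn
  obtain ⟨V, hV1, hV2⟩ := exists_lowerSet_split i v hv B hB n hBn
  -- The two cuts are comparable: the half inside the smaller one misses the half outside the larger
  -- one.
  rcases le_total U V with h | h
  · refine ⟨_, Finset.filter_subset _ _, _, Finset.filter_subset _ _, hU1, hV2, ?_⟩
    intro a ha b hb x hx hy hi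
    rw [Finset.mem_singleton] at hi
    exact (Finset.mem_filter.1 hb).2 x hy hi (h ((Finset.mem_filter.1 ha).2 x hx hi))
  · refine ⟨_, Finset.filter_subset _ _, _, Finset.filter_subset _ _, hU2, hV1, ?_⟩
    intro a ha b hb x hx hy hi
    rw [Finset.mem_singleton] at hi
    exact (Finset.mem_filter.1 ha).2 x hx hi (h ((Finset.mem_filter.1 hb).2 x hy hi))

-- Each triple (two sequences and a level) costs one halving of the two index sets involved, hence
-- the factor `2 ^ T.card`. Disjointness already gained survives passing to subsets.
open Classical in
theorem exists_subfamilies_cross_disjoint {d : ℕ} {P : Set (ℝ × Fin d)} {S : Finset (Fin d)}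
    {m : ℕ} {κ : Type*} (u : Fin m → κ → Set P) (hu : ∀ j a, u j a ∈ traceSets P)
    (hd : ∀ j a b, a ≠ b → DisjointOn S (u j a) (u j b)) (n : ℕ)
    (T : Finset (Fin m × Fin m × Fin d)) (hT : ∀ t ∈ T, t.1 ≠ t.2.1 ∧ t.2.2 ∈ S) :
    ∀ A : Fin m → Finset κ, (∀ j, 2 ^ T.card * n ≤ (A j).card) →
      ∃ A' : Fin m → Finset κ, (∀ j, A' j ⊆ A j ∧ n ≤ (A' j).card) ∧
        ∀ t ∈ T, ∀ a ∈ A' t.1, ∀ b ∈ A' t.2.1, DisjointOn {t.2.2} (u t.1 a) (u t.2.1 b) := by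
  induction T using Finset.induction_on with
  | empty =>
    intro A hA
    exact ⟨A, fun j => ⟨subset_rfl, by simpa using hA j⟩, by simp⟩
  | insert t T ht ih =>
    intro A hA
    obtain ⟨⟨hjk, hi⟩, hT₁⟩ := Finset.forall_mem_insert .. |>.1 hT
    obtain ⟨j, k, i⟩ := t
    simp only at hjk hi
    have hd' : ∀ l, ∀ a ∈ A l, ∀ b ∈ A l, a ≠ b → DisjointOn {i} (u l a) (u l b) :=
      fun l a _ b _ hab => (hd l a b hab).mono (Finset.singleton_subset_iff.2 hi)
    have hcard : ∀ l, 2 * (2 ^ T.card * n) ≤ (A l).card := by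
      intro l
      have := hA l
      rw [Finset.card_insert_of_notMem ht, pow_succ] at this
      linarith
    obtain ⟨X, hX, Y, hY, hXn, hYn, hXY⟩ := exists_cross_disjoint i (u j) (hu j) (u k) (hu k)
      (A j) (hd' j) (A k) (hd' k) _ (hcard j) (hcard k)
    obtain ⟨A', hA', hcross⟩ := ih hT₁ (Function.update (Function.update A j X) k Y) (by
      intro l
      by_cases hlk : l = k
      · subst hlk; simpa using hYn
      by_cases hlj : l = j
      · subst hlj; simpa [Function.update_of_ne hlk] using hXn
      rw [Function.update_of_ne hlk, Function.update_of_ne hlj]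
      have := hcard l
      omega)
    have hj : A' j ⊆ X := by simpa [Function.update_of_ne hjk] using (hA' j).1
    have hk : A' k ⊆ Y := by simpa using (hA' k).1
    refine ⟨A', fun l => ⟨?_, (hA' l).2⟩, ?_⟩
    · by_cases hlk : l = k
      · subst hlk; exact hk.trans hY
      by_cases hlj : l = j
      · subst hlj; exact hj.trans hX
      simpa [Function.update_of_ne hlk, Function.update_of_ne hlj] using (hA' l).1
    · refine Finset.forall_mem_insert .. |>.2 ⟨?_, hcross⟩
      exact fun a ha b hb => hXY a (hj ha) b (hk hb)

open Classical in
/-- From sufficiently long sequences of traces, each pairwise disjoint on `S`, one can extract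
subsequences of length `n` that are also disjoint from each other on `S`. -/
theorem exists_subsequences_cross_disjoint {d : ℕ} (S : Finset (Fin d)) (m n : ℕ) :
    ∃ L : ℕ, ∀ (P : Set (ℝ × Fin d)) (u : Fin m → Fin L → Set P),
      (∀ j a, u j a ∈ traceSets P) → (∀ j a b, a ≠ b → DisjointOn S (u j a) (u j b)) →
      ∃ e : Fin m → Fin n ↪ Fin L, ∀ j k, j ≠ k → ∀ a b,
        DisjointOn S (u j (e j a)) (u k (e k b)) := by
  set T : Finset (Fin m × Fin m × Fin d) :=
    Finset.univ.filter fun t => t.1 ≠ t.2.1 ∧ t.2.2 ∈ S with hT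
  refine ⟨2 ^ T.card * n, fun P u hu hd => ?_⟩
  obtain ⟨A, hA, hcross⟩ := exists_subfamilies_cross_disjoint u hu hd n T
    (fun t ht => (Finset.mem_filter.1 ht).2) (fun _ => Finset.univ) (by simp)
  have he : ∀ j, ∃ e : Fin n ↪ Fin (2 ^ T.card * n), ∀ a, e a ∈ A j := by
    intro j
    obtain ⟨B, hB, hBn⟩ := Finset.exists_subset_card_eq (hA j).2
    exact ⟨(B.orderEmbOfFin hBn).toEmbedding, fun a => hB (Finset.orderEmbOfFin_mem _ _ _)⟩
  choose e he using he
  refine ⟨e, fun j k hjk a b x hx hy hS => ?_⟩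
  exact hcross (j, k, x.1.2) (by simp [hT, hjk, hS]) _ (he j a) _ (he k b) x hx hy (by simp)

/-! ### Many disjoint members or few piercing points -/

open Classical ConvexitySpace in
/-- A family of traces that is nonempty on level `i` is pierced by few points, or it has many
subfamilies that are separated from each other on level `i` and hard to pierce. -/
theorem exists_separated_or_pierces {d : ℕ} {P : Set (ℝ × Fin d)} (i : Fin d) (M n : ℕ) :
    ∀ F : Finset (Set P), (F : Set (Set P)) ⊆ traceSets P → (∀ C ∈ F, ∃ x ∈ C, x.1.2 = i) →
      (∃ G : Fin n → Finset (Set P),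
        (∀ j, G j ⊆ F ∧ ¬ ∃ T : Finset P, T.card ≤ M ∧ Pierces T (G j)) ∧
        ∀ j k, j ≠ k → ∀ C ∈ G j, ∀ D ∈ G k, DisjointOn {i} C D) ∨
      ∃ T : Finset P, T.card ≤ n * (M + 1) ∧ Pierces T F := by
  induction n with
  | zero =>
    intro F _ _
    exact Or.inl ⟨fun j => j.elim0, fun j => j.elim0, fun j => j.elim0⟩
  | succ n ih =>
    intro F hF hne
    set low : Set P → Finset (Set P) := fun C₀ =>
      F.filter fun C => levelLower i C ≤ levelLower i C₀ with hlow
    set H := F.filter fun C₀ => ¬ ∃ T : Finset P, T.card ≤ M ∧ Pierces T (low C₀) with hH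
    rcases H.eq_empty_or_nonempty with h0 | h0
    · right
      rcases F.eq_empty_or_nonempty with hF0 | hF0
      · exact ⟨∅, by simp, by simp [hF0, Pierces]⟩
      obtain ⟨C, hC, hmax⟩ := F.exists_max_image (levelLower i) hF0
      have hCH : C ∉ H := by simp [h0]
      simp only [hH, Finset.mem_filter, hC, true_and, not_not] at hCH
      obtain ⟨T, hTM, hT⟩ := hCH
      refine ⟨T, by nlinarith, fun D hD => hT D (Finset.mem_filter.2 ⟨hD, hmax D hD⟩)⟩
    obtain ⟨C₀, hC₀, hmin⟩ := H.exists_min_image (levelLower i) h0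
    obtain ⟨hC₀F, hC₀H⟩ := Finset.mem_filter.1 hC₀
    -- By minimality of `C₀`, the last member ending before it has an initial segment pierced by `M`
    -- points, and that segment contains every member ending before `C₀`.
    have hlt : ∃ T : Finset P, T.card ≤ M ∧
        Pierces T (F.filter fun C => levelLower i C < levelLower i C₀) := by
      rcases (F.filter fun C => levelLower i C < levelLower i C₀).eq_empty_or_nonempty
        with hE | hE
      · exact ⟨∅, by simp, by simp [hE, Pierces]⟩
      obtain ⟨C, hC, hmax⟩ := Finset.exists_max_image _ (levelLower i) hE
      obtain ⟨hCF, hCC₀⟩ := Finset.mem_filter.1 hC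
      have hCH : C ∉ H := fun h => absurd (hmin C h) (not_le.2 hCC₀)
      simp only [hH, Finset.mem_filter, hCF, true_and, not_not] at hCH
      obtain ⟨T, hTM, hT⟩ := hCH
      exact ⟨T, hTM, fun D hD => hT D (Finset.mem_filter.2
        ⟨(Finset.mem_filter.1 hD).1, hmax D hD⟩)⟩
    obtain ⟨T₁, hT₁M, hT₁⟩ := hlt
    set E := F.filter fun C => levelLower i C₀ ≤ levelLower i C ∧
      ∃ x ∈ C, x.1.2 = i ∧ x.1.1 ∈ levelLower i C₀ with hE
    have hEp : ∃ y : P, ∀ C ∈ E, y ∈ C := by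
      rcases E.eq_empty_or_nonempty with h | h
      · obtain ⟨x, -⟩ := hne C₀ hC₀F
        exact ⟨x, by simp [h]⟩
      obtain ⟨y, -, -, hy⟩ := exists_common_point (i := i) (C₀ := C₀) h
        (fun C hC => hF (Finset.mem_filter.1 hC).1) (fun C hC => (Finset.mem_filter.1 hC).2.1)
        (fun C hC => (Finset.mem_filter.1 hC).2.2)
      exact ⟨y, hy⟩
    obtain ⟨y, hy⟩ := hEp
    -- The members in neither of the two groups above lie beyond `C₀` on level `i`, so they are
    -- separated from `low C₀`. Each round of the induction costs `M` points for the early members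
    -- and one point for `E`.
    set B := F.filter fun C => ∀ x ∈ C, x.1.2 = i → x.1.1 ∉ levelLower i C₀ with hB
    have hBF : B ⊆ F := Finset.filter_subset _ _
    rcases ih B (fun C hC => hF (hBF hC)) (fun C hC => hne C (hBF hC)) with
      ⟨G, hG, hsep⟩ | ⟨T₂, hT₂M, hT₂⟩
    · left
      have hcross : ∀ C ∈ low C₀, ∀ D ∈ B, DisjointOn {i} C D := by
        intro C hC D hD x hx hy hi
        rw [Finset.mem_singleton] at hi
        exact (Finset.mem_filter.1 hD).2 x hy hi
          ((Finset.mem_filter.1 hC).2 (mem_levelLower_of_mem hx hi))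
      refine ⟨Fin.cons (low C₀) G, ?_, ?_⟩
      · refine Fin.cases ?_ fun j => ?_
        · exact ⟨Finset.filter_subset _ _, hC₀H⟩
        · exact ⟨(hG j).1.trans hBF, (hG j).2⟩
      · refine Fin.cases (Fin.cases ?_ fun k => ?_) fun j => Fin.cases ?_ fun k => ?_
        · exact fun h => absurd rfl h
        · exact fun _ C hC D hD => hcross C hC D ((hG k).1 hD)
        · exact fun _ C hC D hD => (hcross D hD C ((hG j).1 hC)).symm
        · exact fun h => hsep j k fun h' => h (h' ▸ rfl)
    · right
      refine ⟨insert y (T₁ ∪ T₂), ?_, ?_⟩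
      · have h1 := Finset.card_insert_le y (T₁ ∪ T₂)
        have h2 := Finset.card_union_le T₁ T₂
        rw [add_mul]
        omega
      · intro C hC
        by_cases hCB : C ∈ B
        · obtain ⟨x, hx, hxC⟩ := hT₂ C hCB
          exact ⟨x, by simp [hx], hxC⟩
        rcases lt_or_ge (levelLower i C) (levelLower i C₀) with h | h
        · obtain ⟨x, hx, hxC⟩ := hT₁ C (Finset.mem_filter.2 ⟨hC, h⟩)
          exact ⟨x, by simp [hx], hxC⟩
        · refine ⟨y, by simp, hy C (Finset.mem_filter.2 ⟨hC, h, ?_⟩)⟩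
          simpa [hB, hC] using hCB

open Classical ConvexitySpace in
/-- A finite family of traces contains `N` members that are pairwise disjoint on `S`, or is pierced
by a bounded number of points. -/
theorem exists_disjointOn_or_pierces {d : ℕ} (P : Set (ℝ × Fin d)) (S : Finset (Fin d)) :
    ∀ N : ℕ, ∃ M : ℕ, ∀ F : Finset (Set P), (F : Set (Set P)) ⊆ traceSets P →
      (∃ s : Fin N → Set P, (∀ j, s j ∈ F) ∧ ∀ j k, j ≠ k → DisjointOn S (s j) (s k)) ∨
      ∃ T : Finset P, T.card ≤ M ∧ Pierces T F := by
  induction S using Finset.induction_on with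
  | empty =>
    refine fun N => ⟨0, fun F _ => ?_⟩
    rcases F.eq_empty_or_nonempty with rfl | ⟨C, hC⟩
    · exact Or.inr ⟨∅, by simp, by simp [Pierces]⟩
    -- Disjointness on no levels is vacuous, so one member may be repeated.
    · exact Or.inl ⟨fun _ => C, fun _ => hC, fun _ _ _ x _ _ => by simp⟩
  | insert i S hi ih =>
    intro N
    -- `N` sequences of length `L` yield one member each, mutually disjoint on `S`; a subfamily that
    -- `M₁` points cannot pierce contains such a sequence. `M₂` takes care of the members that miss
    -- level `i`.
    obtain ⟨L, hL⟩ := exists_subsequences_cross_disjoint S N 1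
    obtain ⟨M₁, hM₁⟩ := ih L
    obtain ⟨M₂, hM₂⟩ := ih N
    refine ⟨N * (M₁ + 1) + M₂, fun F hF => ?_⟩
    set F₁ := F.filter fun C => ∃ x ∈ C, x.1.2 = i with hF₁
    set F₂ := F.filter fun C => ¬ ∃ x ∈ C, x.1.2 = i with hF₂
    have h₁ : F₁ ⊆ F := Finset.filter_subset _ _
    have h₂ : F₂ ⊆ F := Finset.filter_subset _ _
    rcases hM₂ F₂ fun C hC => hF (h₂ hC) with ⟨s, hs, hsd⟩ | ⟨T₂, hT₂M, hT₂⟩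
    · refine Or.inl ⟨s, fun j => h₂ (hs j), fun j k hjk => DisjointOn.insert ?_ (hsd j k hjk)⟩
      intro x hx _ hxi
      exact (Finset.mem_filter.1 (hs j)).2 ⟨x, hx, Finset.mem_singleton.1 hxi⟩
    rcases exists_separated_or_pierces i M₁ N F₁ (fun C hC => hF (h₁ hC))
      (fun C hC => (Finset.mem_filter.1 hC).2) with ⟨G, hG, hsep⟩ | ⟨T₁, hT₁M, hT₁⟩
    · left
      have hs : ∀ j, ∃ s : Fin L → Set P, (∀ a, s a ∈ G j) ∧
          ∀ a b, a ≠ b → DisjointOn S (s a) (s b) := fun j =>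
        (hM₁ (G j) fun C hC => hF (h₁ ((hG j).1 hC))).resolve_right (hG j).2
      choose u hu hud using hs
      obtain ⟨e, he⟩ := hL P u (fun j a => hF (h₁ ((hG j).1 (hu j a)))) hud
      exact ⟨fun j => u j (e j 0), fun j => h₁ ((hG j).1 (hu _ _)), fun j k hjk =>
        DisjointOn.insert (hsep j k hjk _ (hu _ _) _ (hu _ _)) (he j k hjk 0 0)⟩
    · right
      refine ⟨T₁ ∪ T₂, (Finset.card_union_le _ _).trans (by omega), fun C hC => ?_⟩
      by_cases hCi : ∃ x ∈ C, x.1.2 = i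
      · obtain ⟨x, hx, hxC⟩ := hT₁ C (Finset.mem_filter.2 ⟨hC, hCi⟩)
        exact ⟨x, by simp [hx], hxC⟩
      · obtain ⟨x, hx, hxC⟩ := hT₂ C (Finset.mem_filter.2 ⟨hC, hCi⟩)
        exact ⟨x, by simp [hx], hxC⟩

/-! ### The (p,q) theorem and its colorful versions -/

open Classical ConvexitySpace in
theorem admitsPQ {d : ℕ} (P : Set (ℝ × Fin d)) {p q : ℕ} (hq : 2 ≤ q) :
    (traceSpace P).AdmitsPQ p q := by
  obtain ⟨M, hM⟩ := exists_disjointOn_or_pierces P Finset.univ p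
  refine ⟨M, fun F hF hne hpq => ?_⟩
  refine (hM F hF).resolve_left ?_
  rintro ⟨s, hs, hd⟩
  -- The dichotomy allows repetitions, but only of the empty set.
  have hinj : Function.Injective s := by
    intro j k hjk
    by_contra h
    obtain ⟨x, hx⟩ := hne _ (hs j)
    exact hd j k h x hx (hjk ▸ hx) (Finset.mem_univ _)
  obtain ⟨H, hHG, hHq, x, hx⟩ := hpq (Finset.univ.image s)
    (Finset.image_subset_iff.2 fun j _ => hs j)
    (by rw [Finset.card_image_of_injective _ hinj, Finset.card_univ, Fintype.card_fin])
  obtain ⟨C, hC, D, hD, hCD⟩ := Finset.one_lt_card.1 (show 1 < H.card by omega)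
  obtain ⟨j, -, rfl⟩ := Finset.mem_image.1 (hHG hC)
  obtain ⟨k, -, rfl⟩ := Finset.mem_image.1 (hHG hD)
  exact hd j k (fun h => hCD (h ▸ rfl)) x (hx _ hC) (hx _ hD) (Finset.mem_univ _)

open Classical ConvexitySpace in
/-- Among finitely many families of traces, one is pierced by a bounded number of points, or each
contains `n` members such that all these members are pairwise disjoint. -/
theorem exists_pierces_or_cross_disjoint {d : ℕ} (P : Set (ℝ × Fin d)) (m n : ℕ) :
    ∃ M : ℕ, ∀ F : Fin m → Finset (Set P), (∀ i, (F i : Set (Set P)) ⊆ traceSets P) →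
      (∃ (S : Finset P) (i : Fin m), S.card ≤ M ∧ Pierces S (F i)) ∨
      ∃ C : Fin m → Fin n → Set P, (∀ i a, C i a ∈ F i) ∧
        (∀ i a b, a ≠ b → Disjoint (C i a) (C i b)) ∧
        ∀ i k, i ≠ k → ∀ a b, Disjoint (C i a) (C k b) := by
  obtain ⟨L, hL⟩ := exists_subsequences_cross_disjoint (Finset.univ : Finset (Fin d)) m n
  obtain ⟨M, hM⟩ := exists_disjointOn_or_pierces P Finset.univ L
  refine ⟨M, fun F hF => or_iff_not_imp_left.2 fun hcon => ?_⟩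
  have hs : ∀ i, ∃ s : Fin L → Set P, (∀ j, s j ∈ F i) ∧
      ∀ j k, j ≠ k → DisjointOn Finset.univ (s j) (s k) := fun i =>
    (hM (F i) (hF i)).resolve_right fun ⟨T, hT, hTp⟩ => hcon ⟨T, i, hT, hTp⟩
  choose u hu hud using hs
  obtain ⟨e, he⟩ := hL P u (fun i a => hF i (hu i a)) hud
  refine ⟨fun i a => u i (e i a), fun i a => hu i _, fun i a b hab => ?_, fun i k hik a b => ?_⟩
  · exact Set.disjoint_left.2 fun x hx hy =>
      hud i _ _ ((e i).injective.ne hab) x hx hy (Finset.mem_univ _)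
  · exact Set.disjoint_left.2 fun x hx hy => he i k hik a b x hx hy (Finset.mem_univ _)

theorem admitsColorfulPQ₁ {d : ℕ} (P : Set (ℝ × Fin d)) {p q : ℕ} (hq : 2 ≤ q) :
    (traceSpace P).AdmitsColorfulPQ₁ p q := by
  obtain ⟨M, hM⟩ := exists_pierces_or_cross_disjoint P q p
  refine ⟨M, fun F hF hpq => (hM F fun i => (hF i).1).resolve_right ?_⟩
  rintro ⟨C, hC, hd, hcross⟩
  obtain ⟨j, x, hx⟩ := hpq C (fun i a b hab => by
    by_contra h
    obtain ⟨x, hx⟩ := (hF i).2 _ (hC i a)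
    exact Set.disjoint_left.1 (hd i a b h) hx (hab ▸ hx)) hC
  rw [Set.mem_iInter] at hx
  exact Set.disjoint_left.1 (hcross ⟨0, by omega⟩ ⟨1, by omega⟩ (by simp) _ _) (hx _) (hx _)

theorem admitsColorfulPQ₂ {d : ℕ} (P : Set (ℝ × Fin d)) {p q : ℕ} (hq : 2 ≤ q) :
    (traceSpace P).AdmitsColorfulPQ₂ p q := by
  obtain ⟨M, hM⟩ := exists_pierces_or_cross_disjoint P p 1
  refine ⟨M, fun F hF hpq => (hM F hF).resolve_right ?_⟩
  rintro ⟨C, hC, -, hcross⟩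
  obtain ⟨I, hI, x, hx⟩ := hpq (fun i => C i 0) fun i => hC i 0
  obtain ⟨i, hi, k, hk, hik⟩ := Finset.one_lt_card.1 (show 1 < I.card by omega)
  rw [Set.mem_iInter₂] at hx
  exact Set.disjoint_left.1 (hcross i k hik 0 0) (hx i hi) (hx k hk)

/-! ### Colorful Helly and Helly: upper bounds -/

/-- Two families of traces such that each member of the first meets each member of the second on
level `i`: one of them has a common point. -/
theorem exists_common_point_or {d : ℕ} {P : Set (ℝ × Fin d)} (i : Fin d) {F G : Finset (Set P)}
    (hF : (F : Set (Set P)) ⊆ traceSets P) (hG : (G : Set (Set P)) ⊆ traceSets P)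
    (hFne : F.Nonempty) (hGne : G.Nonempty)
    (h : ∀ C ∈ F, ∀ D ∈ G, ∃ x ∈ C, x ∈ D ∧ x.1.2 = i) :
    Intersecting (F : Set (Set P)) ∨ Intersecting (G : Set (Set P)) := by
  obtain ⟨A, hA, hAmin⟩ := F.exists_min_image (levelLower i) hFne
  obtain ⟨B, hB, hBmin⟩ := G.exists_min_image (levelLower i) hGne
  rcases le_total (levelLower i A) (levelLower i B) with hAB | hAB
  · right
    obtain ⟨y, -, -, hy⟩ := exists_common_point (C₀ := A) hGne hG
      (fun D hD => hAB.trans (hBmin D hD)) fun D hD => by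
        obtain ⟨x, hxA, hxD, hxi⟩ := h A hA D hD
        exact ⟨x, hxD, hxi, mem_levelLower_of_mem hxA hxi⟩
    exact ⟨y, fun C hC => hy C hC⟩
  · left
    obtain ⟨y, -, -, hy⟩ := exists_common_point (C₀ := B) hFne hF
      (fun D hD => hAB.trans (hAmin D hD)) fun D hD => by
        obtain ⟨x, hxA, hxD, hxi⟩ := h D hD B hB
        exact ⟨x, hxA, hxi, mem_levelLower_of_mem hxD hxi⟩
    exact ⟨y, fun C hC => hy C hC⟩

theorem colorfulHellyProperty_two_mul {d : ℕ} (P : Set (ℝ × Fin d)) :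
    (traceSpace P).ColorfulHellyProperty (2 * d) := by
  intro F hF hrain
  by_contra! hcon
  -- Two color classes for each level.
  let e : Fin 2 × Fin d ≃ Fin (2 * d) := finProdFinEquiv
  have hpair : ∀ i, ∃ C ∈ F (e (0, i)), ∃ D ∈ F (e (1, i)), ∀ x ∈ C, x ∈ D → x.1.2 ≠ i := by
    intro i
    by_contra! h
    rcases exists_common_point_or i (hF _).2 (hF _).2 (hF _).1 (hF _).1 h with h | h
    · exact hcon _ h
    · exact hcon _ h
  choose C hC D hD hCD using hpair
  obtain ⟨x, hx⟩ := hrain (fun j => ![C (e.symm j).2, D (e.symm j).2] (e.symm j).1) (by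
    intro j
    obtain ⟨⟨b, i⟩, rfl⟩ := e.surjective j
    fin_cases b
    · simpa using hC i
    · simpa using hD i)
  rw [Set.mem_iInter] at hx
  exact hCD x.1.2 x (by simpa using hx (e (0, x.1.2))) (by simpa using hx (e (1, x.1.2))) rfl

open Classical in
theorem ConvexitySpace.ColorfulHellyProperty.hellyProperty {X : Type*} {K : ConvexitySpace X}
    {n : ℕ} (h : K.ColorfulHellyProperty n) : K.HellyProperty n := by
  intro F hF hG
  rcases F.eq_empty_or_nonempty with rfl | hne
  · exact hG ∅ subset_rfl (Nat.zero_le _)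
  obtain ⟨_, hi⟩ := h (fun _ => F) (fun _ => ⟨hne, hF⟩) (fun C hC => by
    obtain ⟨x, hx⟩ := hG (Finset.univ.image C) (Finset.image_subset_iff.2 fun i _ => hC i)
      (Finset.card_image_le.trans (by simp))
    exact ⟨x, Set.mem_iInter.2 fun i => hx _ (by simp)⟩)
  exact hi

theorem ConvexitySpace.hellyNumber_le_colorfulHellyNumber {X : Type*} (K : ConvexitySpace X) :
    K.hellyNumber ≤ K.colorfulHellyNumber :=
  le_iInf₂ fun n hn => iInf₂_le n hn.hellyProperty

/-! ### Convex hulls and the Radon upper bound -/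

/-- The convex hull in the space of traces: on each level, the points between two given points. -/
theorem mem_conv_traceSpace {d : ℕ} {P : Set (ℝ × Fin d)} {Y : Set P} {b : P} :
    b ∈ (traceSpace P).conv Y ↔ ∃ a ∈ Y, ∃ c ∈ Y, a.1.2 = b.1.2 ∧ c.1.2 = b.1.2 ∧
      a.1.1 ≤ b.1.1 ∧ b.1.1 ≤ c.1.1 := by
  constructor
  · intro hb
    refine hb {b : P | ∃ a ∈ Y, ∃ c ∈ Y, a.1.2 = b.1.2 ∧ c.1.2 = b.1.2 ∧
      a.1.1 ≤ b.1.1 ∧ b.1.1 ≤ c.1.1} ⟨(mem_traceSets_iff P _).2 ?_, ?_⟩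
    · rintro a ⟨a₁, ha₁, -, -, h1, -, h2, -⟩ c ⟨-, -, c₁, hc₁, -, h3, -, h4⟩ b hab hcb h5 h6
      exact ⟨a₁, ha₁, c₁, hc₁, h1.trans hab, h3.trans hcb, h2.trans h5, h6.trans h4⟩
    · exact fun a ha => ⟨a, ha, a, ha, rfl, rfl, le_rfl, le_rfl⟩
  · rintro ⟨a, ha, c, hc, h1, h2, h3, h4⟩ C ⟨hC, hYC⟩
    exact (mem_traceSets_iff P C).1 hC a (hYC ha) c (hYC hc) b h1 h2 h3 h4

theorem conv_mem_traceSets {d : ℕ} {P : Set (ℝ × Fin d)} (Y : Set P) :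
    (traceSpace P).conv Y ∈ traceSets P :=
  (traceSpace P).sInter_mem _ ⟨_, (traceSpace P).univ_mem, Set.subset_univ _⟩ fun _ hC => hC.1

theorem subset_conv {X : Type*} (K : ConvexitySpace X) (Y : Set X) : Y ⊆ K.conv Y :=
  fun _ hy _ hC => hC.2 hy

/-- A set with a point of `P` between two others on one level has a Radon
partition. -/
theorem hasRadonPartition_of_between {d : ℕ} {P : Set (ℝ × Fin d)} {Y : Set P} {a b c : P}
    (ha : a ∈ Y) (hb : b ∈ Y) (hc : c ∈ Y) (hab : a ≠ b) (hcb : c ≠ b) (hi : a.1.2 = b.1.2)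
    (hk : c.1.2 = b.1.2) (h₁ : a.1.1 ≤ b.1.1) (h₂ : b.1.1 ≤ c.1.1) :
    (traceSpace P).HasRadonPartition Y :=
  ⟨{b}, Y \ {b}, Set.union_sdiff_cancel (Set.singleton_subset_iff.2 hb),
    Set.disjoint_sdiff_right, b, subset_conv _ _ rfl,
    mem_conv_traceSpace.2 ⟨a, ⟨ha, hab⟩, c, ⟨hc, hcb⟩, hi, hk, h₁, h₂⟩⟩

-- By pigeonhole three of the points share a level, and the middle one lies in the hull of the other
-- two.
open Classical in
theorem radonProperty_two_mul_add_one {d : ℕ} (P : Set (ℝ × Fin d)) :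
    (traceSpace P).RadonProperty (2 * d + 1) := by
  intro Y hY
  obtain ⟨Z, hZY, hZ⟩ := Set.exists_subset_encard_eq hY
  have hfin : Z.Finite := Set.finite_of_encard_eq_coe hZ
  have hcard : (2 * d + 1) = hfin.toFinset.card := by
    rw [hfin.encard_eq_coe_toFinset_card] at hZ
    exact_mod_cast hZ.symm
  obtain ⟨i, -, hi⟩ := Finset.exists_lt_card_fiber_of_mul_lt_card_of_maps_to
    (s := hfin.toFinset) (t := (Finset.univ : Finset (Fin d))) (f := fun x : P => x.1.2) (n := 2)
    (fun _ _ => Finset.mem_univ _) (by rw [← hcard, Finset.card_univ, Fintype.card_fin]; omega)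
  obtain ⟨a, b, c, ha, hb, hc, hab, hac, hbc⟩ := Finset.two_lt_card_iff.1 hi
  simp only [Finset.mem_filter, Set.Finite.mem_toFinset] at ha hb hc
  have haY := hZY ha.1
  have hbY := hZY hb.1
  have hcY := hZY hc.1
  have hi₁ := ha.2.trans hb.2.symm
  have hi₂ := hb.2.trans hc.2.symm
  have hi₃ := ha.2.trans hc.2.symm
  rcases le_total a.1.1 b.1.1 with h1 | h1 <;> rcases le_total b.1.1 c.1.1 with h2 | h2 <;>
    rcases le_total a.1.1 c.1.1 with h3 | h3
  · exact hasRadonPartition_of_between haY hbY hcY hab hbc.symm hi₁ hi₂.symm h1 h2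
  · exact hasRadonPartition_of_between haY hbY hcY hab hbc.symm hi₁ hi₂.symm h1 h2
  · exact hasRadonPartition_of_between haY hcY hbY hac hbc hi₃ hi₂ h3 h2
  · exact hasRadonPartition_of_between hcY haY hbY hac.symm hab.symm hi₃.symm hi₁.symm h3 h1
  · exact hasRadonPartition_of_between hbY haY hcY hab.symm hac.symm hi₁.symm hi₃.symm h1 h3
  · exact hasRadonPartition_of_between hbY hcY haY hbc hac hi₂ hi₃ h2 h3
  · exact hasRadonPartition_of_between hcY hbY haY hbc.symm hab hi₂.symm hi₁ h2 h1
  · exact hasRadonPartition_of_between hcY hbY haY hbc.symm hab hi₂.symm hi₁ h2 h1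

/-! ### Lower bounds for the Radon and Helly numbers -/

/-- If every level has two points, there are two injectively chosen points on each level. -/
theorem exists_two_points {d : ℕ} {P : Set (ℝ × Fin d)}
    (h : ∀ i : Fin d, 2 ≤ {x : ℝ | (x, i) ∈ P}.encard) :
    ∃ y : Fin d × Bool → P, Function.Injective y ∧ ∀ t, (y t).1.2 = t.1 := by
  have h' : ∀ i, ∃ a b : ℝ, (a, i) ∈ P ∧ (b, i) ∈ P ∧ a ≠ b := by
    intro i
    obtain ⟨a, b, ha, hb, hab⟩ := Set.one_lt_encard_iff.1
      (lt_of_lt_of_le (by norm_num : (1 : ℕ∞) < 2) (h i))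
    exact ⟨a, b, ha, hb, hab⟩
  choose a b ha hb hab using h'
  refine ⟨fun t => if t.2 then ⟨(a t.1, t.1), ha t.1⟩ else ⟨(b t.1, t.1), hb t.1⟩, ?_, ?_⟩
  · rintro ⟨i, _ | _⟩ ⟨k, _ | _⟩ hik <;> simp_all
    · exact hab k (hik.2 ▸ hik.1).symm
    · exact hab k (hik.2 ▸ hik.1)
  · rintro ⟨i, _ | _⟩ <;> simp

theorem eq_of_level_eq {d : ℕ} {P : Set (ℝ × Fin d)} {a b : P} (h₁ : a.1.1 = b.1.1)
    (h₂ : a.1.2 = b.1.2) : a = b :=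
  Subtype.ext (Prod.ext h₁ h₂)

/-- Two points per level have no Radon partition: on the level of a common point of the hulls, each
part would own exactly one of the two points, and the common point would equal both. -/
theorem le_of_radonProperty {d : ℕ} {P : Set (ℝ × Fin d)}
    (h : ∀ i : Fin d, 2 ≤ {x : ℝ | (x, i) ∈ P}.encard) {n : ℕ}
    (hn : (traceSpace P).RadonProperty n) : 2 * d + 1 ≤ n := by
  by_contra! hlt
  obtain ⟨y, hy, hlev⟩ := exists_two_points h
  obtain ⟨A, B, hAB, hdis, x, hxA, hxB⟩ := hn (Set.range y) (by
    rw [← Set.image_univ, hy.encard_image, Set.encard_univ, ENat.card_eq_coe_fintype_card]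
    simp only [Fintype.card_prod, Fintype.card_fin, Fintype.card_bool]
    exact_mod_cast (by omega : n ≤ d * 2))
  obtain ⟨a, ha, c, hc, hax, hcx, hax', hcx'⟩ := mem_conv_traceSpace.1 hxA
  obtain ⟨a', ha', c', hc', hbx, hdx, hbx', hdx'⟩ := mem_conv_traceSpace.1 hxB
  have key : ∀ z ∈ A ∪ B, z.1.2 = x.1.2 → ∃ s, z = y (x.1.2, s) := by
    intro z hz hzx
    obtain ⟨⟨i, s⟩, rfl⟩ := hAB ▸ hz
    exact ⟨s, by rw [← hzx, hlev]⟩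
  obtain ⟨s, rfl⟩ := key a (Or.inl ha) hax
  obtain ⟨s', rfl⟩ := key c (Or.inl hc) hcx
  obtain ⟨t, rfl⟩ := key a' (Or.inr ha') hbx
  obtain ⟨t', rfl⟩ := key c' (Or.inr hc') hdx
  rw [Set.disjoint_left] at hdis
  have h1 : s ≠ t := fun e => hdis ha (e ▸ ha')
  have h2 : s ≠ t' := fun e => hdis ha (e ▸ hc')
  have h3 : s' ≠ t := fun e => hdis hc (e ▸ ha')
  have bool_eq : ∀ b₁ b₂ b₃ : Bool, b₁ ≠ b₃ → b₂ ≠ b₃ → b₁ = b₂ := by decide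
  obtain rfl := bool_eq s s' t h1 h3
  obtain rfl := bool_eq t t' s h1.symm h2.symm
  have e : y (x.1.2, s) = y (x.1.2, t) :=
    (eq_of_level_eq (le_antisymm hax' hcx') hax).trans
      (eq_of_level_eq (le_antisymm hbx' hdx') hbx).symm
  exact hdis ha (e ▸ ha')

-- The extremal family consists of the hulls of all but one of the `2 * d` chosen points. Omitting a
-- hull frees its omitted point to lie in all the others, while on each level two of the hulls
-- reduce to different single points.
open Classical in
theorem le_of_hellyProperty {d : ℕ} {P : Set (ℝ × Fin d)}
    (h : ∀ i : Fin d, 2 ≤ {x : ℝ | (x, i) ∈ P}.encard) {n : ℕ}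
    (hn : (traceSpace P).HellyProperty n) : 2 * d ≤ n := by
  by_contra! hlt
  obtain ⟨y, hy, hlev⟩ := exists_two_points h
  set C : Fin d × Bool → Set P := fun t => (traceSpace P).conv (y '' {t}ᶜ) with hC
  have hmem : ∀ t t', t' ≠ t → y t' ∈ C t := fun t t' htt =>
    subset_conv _ _ (Set.mem_image_of_mem y htt)
  have heq : ∀ t, ∀ x ∈ C t, x.1.2 = t.1 → x = y (t.1, !t.2) := by
    rintro ⟨i, s⟩ x hx rfl
    obtain ⟨_, ⟨⟨j, a⟩, ha, rfl⟩, _, ⟨⟨k, c⟩, hc, rfl⟩, hax, hcx, hax', hcx'⟩ :=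
      mem_conv_traceSpace.1 hx
    rw [hlev] at hax hcx
    simp only at hax hcx
    subst hax hcx
    have ha' : a = !s := by cases a <;> cases s <;> simp_all
    have hc' : c = !s := by cases c <;> cases s <;> simp_all
    subst ha' hc'
    exact eq_of_level_eq (le_antisymm hcx' hax') (hlev (x.1.2, !s)).symm
  have hnot : ∀ t, y t ∉ C t := by
    intro t ht
    have := congrArg Prod.snd (hy (heq t _ ht (hlev t)))
    cases t with | mk i s => cases s <;> simp at this
  have hinj : Function.Injective C := by
    intro t t' htt
    by_contra hne
    exact hnot t (htt ▸ hmem t' t hne)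
  obtain ⟨x, hx⟩ := hn (Finset.univ.image C) (by
      intro D hD
      obtain ⟨t, -, rfl⟩ := Finset.mem_image.1 hD
      exact conv_mem_traceSets _) (by
    intro G hG hGn
    have hlt' : G.card < (Finset.univ.image C).card := by
      rw [Finset.card_image_of_injective _ hinj, Finset.card_univ]
      simp only [Fintype.card_prod, Fintype.card_fin, Fintype.card_bool]
      omega
    obtain ⟨D, hD, hDG⟩ := Finset.exists_mem_notMem_of_card_lt_card hlt'
    obtain ⟨t, -, rfl⟩ := Finset.mem_image.1 hD
    refine ⟨y t, fun D' hD' => ?_⟩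
    obtain ⟨t', -, rfl⟩ := Finset.mem_image.1 (hG hD')
    exact hmem t' t fun e => hDG (e ▸ hD'))
  have hall : ∀ t, x ∈ C t := fun t => hx _ (by simp)
  have e := (heq (x.1.2, false) x (hall _) rfl).symm.trans (heq (x.1.2, true) x (hall _) rfl)
  simpa using congrArg Prod.snd (hy e)

/-! ### Fractional Helly -/

open Classical in
/-- The members of `F` that reach at least as far right on level `i` as `A`, and that meet there
the lower set generated by `A`. -/
noncomputable def rightNeighbors {d : ℕ} {P : Set (ℝ × Fin d)} (F : Finset (Set P)) (i : Fin d)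
    (A : Set P) : Finset (Set P) :=
  F.filter fun B => levelLower i A ≤ levelLower i B ∧
    ∃ x ∈ B, x.1.2 = i ∧ x.1.1 ∈ levelLower i A

-- The definition of `numIntersecting` coerces the `k`-subsets to sets before filtering; the
-- coercion is injective, so the count is unchanged.
open Classical in
theorem ConvexitySpace.numIntersecting_eq {X : Type*} (F : Finset (Set X)) (k : ℕ) :
    ConvexitySpace.numIntersecting F k =
      ((F.powersetCard k).filter fun G : Finset (Set X) =>
        Intersecting (G : Set (Set X))).card := by
  refine Eq.symm (Finset.card_bij (fun G _ => (G : Set (Set X))) ?_ ?_ ?_)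
  · intro G hG
    obtain ⟨hG, hI⟩ := Finset.mem_filter.1 hG
    simp only [Finset.mem_filter, Finset.bind_def, Finset.pure_def, Finset.mem_sup,
      Finset.mem_singleton]
    exact ⟨⟨G, hG, rfl⟩, hI⟩
  · exact fun G _ H _ h => Finset.coe_injective h
  · intro G hG
    simp only [Finset.mem_filter, Finset.bind_def, Finset.pure_def, Finset.mem_sup,
      Finset.mem_singleton] at hG
    obtain ⟨⟨H, hH, rfl⟩, hI⟩ := hG
    exact ⟨H, Finset.mem_filter.2 ⟨hH, hI⟩, rfl⟩

-- Each intersecting pair is charged to the level of a common point and to the member ending earlier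
-- there; the other member is then one of its right neighbors.
open Classical in
theorem numIntersecting_two_le {d : ℕ} {P : Set (ℝ × Fin d)} (F : Finset (Set P)) :
    ConvexitySpace.numIntersecting F 2 ≤
      ∑ t ∈ (Finset.univ : Finset (Fin d)) ×ˢ F, ((rightNeighbors F t.1 t.2).erase t.2).card := by
  have hsub : ((F.powersetCard 2).filter fun G : Finset (Set P) => Intersecting (G : Set (Set P))) ⊆
      ((Finset.univ : Finset (Fin d)) ×ˢ F).biUnion fun t =>
        ((rightNeighbors F t.1 t.2).erase t.2).image fun B => {t.2, B} := by
    intro G hG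
    obtain ⟨hG, x, hx⟩ := Finset.mem_filter.1 hG
    obtain ⟨hGF, hG2⟩ := Finset.mem_powersetCard.1 hG
    obtain ⟨A, B, hAB, rfl⟩ := Finset.card_eq_two.1 hG2
    have hA : A ∈ F := hGF (by simp)
    have hB : B ∈ F := hGF (by simp)
    have hxA : x ∈ A := hx A (by simp)
    have hxB : x ∈ B := hx B (by simp)
    simp only [Finset.mem_biUnion, Finset.mem_product, Finset.mem_univ, true_and,
      Finset.mem_image, Finset.mem_erase, rightNeighbors, Finset.mem_filter]
    rcases le_total (levelLower x.1.2 A) (levelLower x.1.2 B) with hle | hle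
    · exact ⟨(x.1.2, A), hA, B, ⟨hAB.symm, hB, hle, x, hxB, rfl, mem_levelLower_of_mem hxA rfl⟩,
        rfl⟩
    · exact ⟨(x.1.2, B), hB, A, ⟨hAB, hA, hle, x, hxA, rfl, mem_levelLower_of_mem hxB rfl⟩,
        Finset.pair_comm _ _⟩
  rw [ConvexitySpace.numIntersecting_eq]
  exact (Finset.card_le_card hsub).trans (Finset.card_biUnion_le.trans
    (Finset.sum_le_sum fun t _ => Finset.card_image_le))

theorem intersecting_rightNeighbors {d : ℕ} {P : Set (ℝ × Fin d)} {F : Finset (Set P)}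
    (hF : (F : Set (Set P)) ⊆ traceSets P) {i : Fin d} {A : Set P}
    (hne : (rightNeighbors F i A).Nonempty) :
    Intersecting (rightNeighbors F i A : Set (Set P)) := by
  classical
  obtain ⟨y, -, -, hy⟩ := exists_common_point (C₀ := A) hne
    (fun B hB => hF (Finset.mem_filter.1 hB).1) (fun B hB => (Finset.mem_filter.1 hB).2.1)
    fun B hB => (Finset.mem_filter.1 hB).2.2
  exact ⟨y, fun B hB => hy B hB⟩

theorem mem_rightNeighbors_self {d : ℕ} {P : Set (ℝ × Fin d)} {F : Finset (Set P)} {i : Fin d}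
    {A : Set P} (hA : A ∈ F) (hne : (rightNeighbors F i A).Nonempty) :
    A ∈ rightNeighbors F i A := by
  classical
  obtain ⟨B, hB⟩ := hne
  obtain ⟨-, -, x, -, -, hx⟩ := Finset.mem_filter.1 hB
  obtain ⟨z, hz, hzi, -⟩ := mem_levelLower.1 hx
  exact Finset.mem_filter.2 ⟨hA, le_rfl, z, hz, hzi, mem_levelLower_of_mem hz hzi⟩

open Classical in
theorem admitsFractionalHelly_two {d : ℕ} (hd : 1 ≤ d) (P : Set (ℝ × Fin d)) :
    (traceSpace P).AdmitsFractionalHelly 2 := by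
  have hd' : (1 : ℝ) ≤ d := by exact_mod_cast hd
  -- With `n` members and all intersecting subfamilies smaller than `β n`, the charging gives at
  -- most `d n (β n - 1) = α n² / 2 - d n` pairs, fewer than `α n (n - 1) / 2` since `α < d`.
  refine ⟨fun α => α / (2 * d), ?_, ?_⟩
  · rintro α ⟨h0, h1⟩
    refine ⟨by positivity, ?_⟩
    rw [div_lt_one (by positivity)]
    linarith
  rintro α ⟨h0, h1⟩ F hF hF2 hnum
  by_contra! hcon
  have hF2' : (2 : ℝ) ≤ F.card := by exact_mod_cast hF2
  have hpos : (0 : ℝ) < F.card.choose 2 := by exact_mod_cast Nat.choose_pos hF2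
  have hnum' : (0 : ℝ) < ConvexitySpace.numIntersecting F 2 := by
    have := mul_pos h0 hpos
    linarith
  rw [Nat.cast_pos, ConvexitySpace.numIntersecting_eq] at hnum'
  -- One intersecting pair already forces `β n > 2`, so the bound `β n - 1` also holds for members
  -- without right neighbors.
  obtain ⟨H, hH⟩ := Finset.card_pos.1 hnum'
  obtain ⟨hH, hHint⟩ := Finset.mem_filter.1 hH
  obtain ⟨hHF, hH2⟩ := Finset.mem_powersetCard.1 hH
  have h2 := hcon H hHF hHint
  rw [hH2, Nat.cast_ofNat] at h2
  have hle : ∀ t ∈ (Finset.univ : Finset (Fin d)) ×ˢ F,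
      (((rightNeighbors F t.1 t.2).erase t.2).card : ℝ) ≤ α / (2 * d) * F.card - 1 := by
    rintro ⟨i, A⟩ hA
    have hAF : A ∈ F := (Finset.mem_product.1 hA).2
    rcases (rightNeighbors F i A).eq_empty_or_nonempty with h | h
    · simp only [h, Finset.erase_empty, Finset.card_empty, Nat.cast_zero]
      linarith
    · have h3 := hcon _ (Finset.filter_subset _ _) (intersecting_rightNeighbors hF h)
      have h4 := Finset.card_erase_add_one (mem_rightNeighbors_self hAF h)
      have h5 : (((rightNeighbors F i A).erase A).card : ℝ) + 1 = (rightNeighbors F i A).card := by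
        exact_mod_cast h4
      change ((rightNeighbors F i A).card : ℝ) < _ at h3
      simp only
      linarith
  have hsum : (ConvexitySpace.numIntersecting F 2 : ℝ) ≤
      d * F.card * (α / (2 * d) * F.card - 1) := by
    calc (ConvexitySpace.numIntersecting F 2 : ℝ)
        ≤ ∑ t ∈ (Finset.univ : Finset (Fin d)) ×ˢ F,
            (((rightNeighbors F t.1 t.2).erase t.2).card : ℝ) := by
          exact_mod_cast numIntersecting_two_le F
      _ ≤ _ := Finset.sum_le_card_nsmul _ _ _ hle
      _ = _ := by simp [Finset.card_product]
  rw [Nat.cast_choose_two] at hnum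
  have hexp : d * F.card * (α / (2 * d) * F.card - 1) =
      α * F.card * F.card / 2 - d * (F.card : ℝ) := by
    field_simp
  have hαd : α * F.card < d * F.card := by
    apply mul_lt_mul_of_pos_right <;> linarith
  have hαn : 0 < α * F.card := by positivity
  nlinarith

theorem singleton_mem_traceSets {d : ℕ} {P : Set (ℝ × Fin d)} (x : P) :
    ({x} : Set P) ∈ traceSets P := by
  rw [mem_traceSets_iff]
  rintro a rfl c rfl b h _ h1 h2
  exact (eq_of_level_eq (le_antisymm h1 h2) h).symm

-- In a family of distinct singletons every subfamily of at most one set intersects, but no two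
-- members do; the family has more than `1 / β (1 / 2)` members.
open Classical in
theorem two_le_of_admitsFractionalHelly {d : ℕ} {P : Set (ℝ × Fin d)} (hP : P.Infinite) {k : ℕ}
    (hk : (traceSpace P).AdmitsFractionalHelly k) : 2 ≤ k := by
  by_contra! hlt
  obtain ⟨β, hβ, h⟩ := hk
  have hα : (1 / 2 : ℝ) ∈ Set.Ioo (0 : ℝ) 1 := by constructor <;> norm_num
  have hβ0 := (hβ _ hα).1
  have : Infinite P := hP.to_subtype
  obtain ⟨n, hn⟩ := exists_nat_gt (1 / β (1 / 2))
  obtain ⟨Y, hY⟩ := Infinite.exists_subset_card_eq P (n + 1)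
  set F : Finset (Set P) := Y.image fun x => {x} with hF
  have hFcard : F.card = n + 1 := by
    rw [hF, Finset.card_image_of_injective _ Set.singleton_injective, hY]
  have hsingle : ∀ C ∈ F, ∃ x : P, C = {x} := by
    intro C hC
    obtain ⟨x, -, rfl⟩ := Finset.mem_image.1 hC
    exact ⟨x, rfl⟩
  obtain ⟨G, hGF, ⟨x, hx⟩, hG⟩ := h _ hα F (fun C hC => by
      obtain ⟨x, rfl⟩ := hsingle C hC
      exact singleton_mem_traceSets x) (by omega) (by
    have hall : ConvexitySpace.numIntersecting F k = F.card.choose k := by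
      rw [ConvexitySpace.numIntersecting_eq, Finset.filter_true_of_mem, Finset.card_powersetCard]
      intro G hG
      obtain ⟨hGF, hGk⟩ := Finset.mem_powersetCard.1 hG
      rcases G.eq_empty_or_nonempty with rfl | ⟨C, hC⟩
      · exact ⟨Classical.arbitrary P, by simp⟩
      · obtain ⟨x, rfl⟩ := hsingle C (hGF hC)
        refine ⟨x, fun D hD => ?_⟩
        rw [Finset.card_le_one.1 (by omega : G.card ≤ 1) D hD _ hC]
        rfl
    rw [hall]
    have : (0 : ℝ) ≤ F.card.choose k := Nat.cast_nonneg _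
    linarith)
  have hG1 : G.card ≤ 1 := by
    refine Finset.card_le_one.2 fun C hC D hD => ?_
    obtain ⟨c, rfl⟩ := hsingle C (hGF hC)
    obtain ⟨e, rfl⟩ := hsingle D (hGF hD)
    rw [← show x = c from hx _ hC, ← show x = e from hx _ hD]
  have hG1' : (G.card : ℝ) ≤ 1 := by exact_mod_cast hG1
  rw [div_lt_iff₀ hβ0] at hn
  rw [hFcard] at hG
  push_cast at hG
  nlinarith

/-! ### The theorem -/

theorem mainTheorem1 (d : ℕ) (hd : 1 ≤ d) (P : Set (ℝ × Fin d)) :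
    ((traceSpace P).radonNumber ≤ 2 * d + 1 ∧
      ((∀ i : Fin d, 2 ≤ {x : ℝ | (x, i) ∈ P}.encard) →
        (traceSpace P).radonNumber = 2 * d + 1)) ∧
    ((traceSpace P).hellyNumber ≤ 2 * d ∧
      ((∀ i : Fin d, 2 ≤ {x : ℝ | (x, i) ∈ P}.encard) →
        (traceSpace P).hellyNumber = 2 * d)) ∧
    ((traceSpace P).colorfulHellyNumber ≤ 2 * d ∧
      ((∀ i : Fin d, 2 ≤ {x : ℝ | (x, i) ∈ P}.encard) →
        (traceSpace P).colorfulHellyNumber = 2 * d)) ∧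
    ((traceSpace P).fractionalHellyNumber ≤ 2 ∧
      (P.Infinite → (traceSpace P).fractionalHellyNumber = 2)) ∧
    (∀ p q : ℕ, 2 ≤ q → q ≤ p → (traceSpace P).AdmitsPQ p q) ∧
    (∀ p q : ℕ, 2 ≤ q → q ≤ p → (traceSpace P).AdmitsColorfulPQ₁ p q) ∧
    (∀ p q : ℕ, 2 ≤ q → q ≤ p → (traceSpace P).AdmitsColorfulPQ₂ p q) := by
  have hr : (traceSpace P).radonNumber ≤ 2 * d + 1 := by
    exact_mod_cast iInf₂_le (2 * d + 1) (radonProperty_two_mul_add_one P)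
  have hc : (traceSpace P).colorfulHellyNumber ≤ 2 * d := by
    exact_mod_cast iInf₂_le (2 * d) (colorfulHellyProperty_two_mul P)
  have hhc := (traceSpace P).hellyNumber_le_colorfulHellyNumber
  have hf : (traceSpace P).fractionalHellyNumber ≤ 2 := by
    exact_mod_cast iInf₂_le 2 (admitsFractionalHelly_two hd P)
  -- This bound also serves the colorful Helly number, which is at least the Helly number.
  have hh : (∀ i : Fin d, 2 ≤ {x : ℝ | (x, i) ∈ P}.encard) →
      2 * d ≤ (traceSpace P).hellyNumber :=
    fun h => le_iInf₂ fun n hn => by exact_mod_cast le_of_hellyProperty h hn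
  refine ⟨⟨hr, fun h => hr.antisymm (le_iInf₂ fun n hn => ?_)⟩,
    ⟨hhc.trans hc, fun h => (hhc.trans hc).antisymm (hh h)⟩,
    ⟨hc, fun h => hc.antisymm ((hh h).trans hhc)⟩,
    ⟨hf, fun h => hf.antisymm (le_iInf₂ fun k hk => ?_)⟩,
    fun p q hq _ => admitsPQ P hq, fun p q hq _ => admitsColorfulPQ₁ P hq,
    fun p q hq _ => admitsColorfulPQ₂ P hq⟩
  · exact_mod_cast le_of_radonProperty h hn
  · exact_mod_cast two_le_of_admitsFractionalHelly h hk
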